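/- A tournament $T=(V,E)$ is a (possibly infinite) set $V$ of vertices with an irreflexive, antisymmetric and complete binary relation $E\subseteq V\times V$ (so that for any two distinct vertices $x,y$ exactly one of $(x,y),(y,x)$ belongs to $E$). A set $A\subseteq V$ is autonomous if for all $x,x'\in A$ and $y\in V\setminus A$ one has $(x,y)\in E$ if and only if $(x',y)\in E$; the tournament $T$ is indecomposable if its only autonomous sets are $\emptyset$, the singletons and $V$. The profile of $T$ is the function $\varphi_T$ whose value $\varphi_T(n)$ at each integer $n\ge 0$ is the number of subtournaments induced by $T$ on the $n$-element subsets of $V$, counted up to isomorphism. Corollary. The growth of the profile of every infinite indecomposable tournament is at least exponential: if $T$ is an indecomposable tournament with infinite vertex set, then there are real numbers $a>0$ and $c>1$ such that $\varphi_T(n)\geq a\,c^n$ for every integer $n\geq 0$. -/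

import Mathlib

/-- A tournament on the vertex type `V`: a directed graph whose edge relation is irreflexive,
antisymmetric and complete. -/
structure Tournament (V : Type*) extends Digraph V where
  irrefl : ∀ x, ¬ Adj x x
  antisymm : ∀ x y, Adj x y → Adj y x → x = y
  complete : ∀ x y, x ≠ y → Adj x y ∨ Adj y x

namespace Tournament

/-- Isomorphisms of tournaments: bijections preserving and reflecting the edge relation. -/
abbrev Iso {V W : Type*} (T : Tournament V) (S : Tournament W) := T.Adj ≃r S.Adj

/-- The subtournament of `T` induced on the set of vertices `A`. -/
def induce {V : Type*} (T : Tournament V) (A : Set V) : Tournament A where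
  Adj x y := T.Adj x y
  irrefl x := T.irrefl x
  antisymm x y h h' := Subtype.ext (T.antisymm x y h h')
  complete x y h := T.complete x y (fun e => h (Subtype.ext e))

/-- A set of vertices is autonomous if no vertex outside of it distinguishes two of its members. -/
def IsAutonomous {V : Type*} (T : Tournament V) (A : Set V) : Prop :=
  ∀ x ∈ A, ∀ x' ∈ A, ∀ y ∉ A, (T.Adj x y ↔ T.Adj x' y)

/-- A tournament is indecomposable (or simple) if its only autonomous sets are the trivial ones:
the empty set, the singletons and the whole vertex set. -/
def IsIndecomposable {V : Type*} (T : Tournament V) : Prop :=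
  ∀ A : Set V, T.IsAutonomous A → A = ∅ ∨ (∃ x, A = {x}) ∨ A = Set.univ

/-- On the `n`-element sets of vertices, the equivalence relation
"the induced subtournaments are isomorphic". -/
def isoSetoid {V : Type*} (T : Tournament V) (n : ℕ) : Setoid {A : Finset V // A.card = n} where
  r A B := Nonempty ((T.induce (A.1 : Set V)).Iso (T.induce (B.1 : Set V)))
  iseqv :=
    { refl := fun _ => ⟨RelIso.refl _⟩
      symm := fun ⟨f⟩ => ⟨f.symm⟩
      trans := fun ⟨f⟩ ⟨g⟩ => ⟨f.trans g⟩ }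

/-- There are only finitely many isomorphism types of subtournaments induced on `n` vertices, so
that the cardinality in the definition of the profile below is a genuine one. -/
instance finite_quotient_isoSetoid {V : Type*} (T : Tournament V) (n : ℕ) :
    Finite (Quotient (T.isoSetoid n)) := by
  classical
  let e : (A : {A : Finset V // A.card = n}) → A.1 ≃ Fin n := fun A => A.1.equivFinOfCardEq A.2
  let F : Quotient (T.isoSetoid n) → (Fin n → Fin n → Prop) := fun q i j =>
    T.Adj ((e q.out).symm i) ((e q.out).symm j)
  refine Finite.of_injective F fun p q h => ?_
  rw [← Quotient.out_eq p, ← Quotient.out_eq q]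
  refine Quotient.sound ⟨⟨(e p.out).trans (e q.out).symm, ?_⟩⟩
  intro a b
  have := congrFun (congrFun h (e p.out a)) (e p.out b)
  simp only [F, Equiv.symm_apply_apply] at this
  exact (iff_of_eq this).symm

/-- The profile of `T`: the number of subtournaments induced by `T` on the `n`-element sets of
vertices, isomorphic ones being identified. -/
noncomputable def profile {V : Type*} (T : Tournament V) (n : ℕ) : ℕ :=
  Nat.card (Quotient (T.isoSetoid n))

end Tournament

/-- The growth of `f` is at least exponential. -/
def GrowthAtLeastExponential (f : ℕ → ℕ) : Prop :=
  ∃ a c : ℝ, 0 < a ∧ 1 < c ∧ ∀ n : ℕ, a * c ^ n ≤ (f n : ℝ)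

/-!
By Ramsey's theorem `T` contains an infinite chain, say `a i → a j` for `i < j` (otherwise reverse
all the edges). Indecomposability applied to the closed interval between `a (2 * i)` and
`a (2 * i + 1)` yields a three-cycle that involves these two vertices or one vertex inside the
interval. By Ramsey's theorem again, the vertices so obtained may be assumed to form finitely many
columns that are order-indiscernible. If a new column `v` fails to follow the chain, then one finds
a chain `b`, a sequence `d` of letters whose sets of dominated vertices of `b` are nested, and a
vertex `p` separating `b` from `d`; once `p` is fixed, `b` and hence the letters are recognizable
from the isomorphism type, so that subtournaments of linear size code arbitrary binary words.
Otherwise the three-cycles are stacked one above the other, and words are coded by lexicographic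
sums of three-cycles and singletons, the chain being recognized as the set of vertices on no
three-cycle. In both cases, as fixing one vertex only costs a linear factor, the profile grows at
least exponentially.
-/

theorem GrowthAtLeastExponential.of_mul_pow_le {f : ℕ → ℕ} {a r : ℝ} (ha : 0 < a) (hr : 1 < r)
    (h : ∀ n : ℕ, a * r ^ n ≤ (n + 1) * f n) : GrowthAtLeastExponential f := by
  set c := √r
  have hc : 1 < c := Real.lt_sqrt_of_sq_lt (by simpa using hr)
  have hcr : c * c = r := Real.mul_self_sqrt (by linarith)
  have bernoulli (n : ℕ) : (n + 1) * (c - 1) ≤ c * c ^ n := by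
    have := one_add_mul_sub_le_pow (show -1 ≤ c by linarith) (n + 1)
    push_cast at this
    linarith [pow_succ' c n]
  refine ⟨a * (c - 1) / c, c, by have := sub_pos.2 hc; positivity, hc, fun n => ?_⟩
  rw [div_mul_eq_mul_div, div_le_iff₀ (by positivity)]
  refine le_of_mul_le_mul_left ?_ (n.cast_add_one_pos (α := ℝ))
  calc (n + 1) * (a * (c - 1) * c ^ n) = a * ((n + 1) * (c - 1)) * c ^ n := by ring
    _ ≤ a * (c * c ^ n) * c ^ n := by gcongr a * ?_ * _; exact bernoulli n
    _ = c * (a * r ^ n) := by rw [← hcr, mul_pow]; ring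
    _ ≤ c * ((n + 1) * f n) := by gcongr c * ?_; exact h n
    _ = (n + 1) * (f n * c) := by ring

theorem GrowthAtLeastExponential.of_two_pow_le {f : ℕ → ℕ} (s : ℕ) (h₀ : 0 < f 0)
    (h : ∀ m N, 2 * m ≤ N → 2 ^ m ≤ (N + m * s + 1) * f (N + m * s + 1)) :
    GrowthAtLeastExponential f := by
  set L := s + 2
  set r : ℝ := 2 ^ ((L : ℝ)⁻¹)
  have hr : 1 < r := Real.one_lt_rpow one_lt_two (by positivity)
  have hrL : r ^ L = 2 := Real.rpow_inv_natCast_pow zero_le_two (by positivity)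
  refine .of_mul_pow_le one_half_pos hr fun n => ?_
  rcases n with - | n
  · have : (1 : ℝ) ≤ f 0 := by exact_mod_cast h₀
    norm_num
    linarith
  · -- `n + 1` is `N + m * s + 1` for `N = n - m * s`, and `2 * m ≤ N` because `m = n / (s + 2)`.
    set m := n / L
    have hm : m * L ≤ n := Nat.div_mul_le_self n L
    have hn : n + 1 ≤ L * (m + 1) := Nat.lt_mul_div_succ n (by positivity)
    have hf : 2 ^ m ≤ (n + 1) * f (n + 1) := by
      have := h m (n - m * s) (by rw [mul_add] at hm; omega)
      rwa [Nat.sub_add_cancel (by rw [mul_add] at hm; omega)] at this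
    calc 1 / 2 * r ^ (n + 1) ≤ 1 / 2 * r ^ (L * (m + 1)) := by
          gcongr
          exact hr.le
      _ = 2 ^ m := by rw [pow_mul, hrL]; ring
      _ ≤ ((n + 1 : ℕ) : ℝ) * f (n + 1) := by exact_mod_cast hf
      _ ≤ ((n + 1 : ℕ) + 1) * f (n + 1) := by gcongr; linarith

theorem exists_strictMono_monochromatic {κ : Type*} [Finite κ] (f : ℕ → ℕ → κ) :
    ∃ (φ : ℕ → ℕ) (c : κ), StrictMono φ ∧ ∀ i j, i < j → f (φ i) (φ j) = c := by
  let U : Ultrafilter ℕ := Filter.hyperfilter ℕ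
  have exists_eventually_eq (g : ℕ → κ) : ∃ c, ∀ᶠ j in (U : Filter ℕ), g j = c := by
    obtain ⟨c, hc⟩ := (U.map g).eq_pure_of_finite
    exact ⟨c, show {c} ∈ U.map g from hc ▸ Set.mem_singleton c⟩
  choose d hd using fun i => exists_eventually_eq (f i)
  obtain ⟨c, hc⟩ := exists_eventually_eq d
  have exists_next (s : Finset ℕ) (hs : ∀ i ∈ s, d i = c) :
      ∃ j, d j = c ∧ ∀ i ∈ s, i < j ∧ f i j = c := by
    refine (hc.and ((Filter.eventually_all_finset s).2 fun i hi => ?_)).exists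
    have hij : ∀ᶠ j in (U : Filter ℕ), i < j :=
      (Filter.eventually_gt_atTop i).filter_mono Nat.hyperfilter_le_atTop
    exact hij.and ((hd i).mono fun j hj => hj.trans (hs i hi))
  obtain ⟨φ, -, hφ⟩ := exists_seq_of_forall_finset_exists _ _ exists_next
  exact ⟨φ, c, fun i j hij => (hφ i j hij).1, fun i j hij => (hφ i j hij).2⟩

namespace Tournament

variable {V : Type*} (T : Tournament V)

theorem ne_of_adj {x y : V} (h : T.Adj x y) : x ≠ y := by
  rintro rfl
  exact T.irrefl x h

theorem not_adj_of_adj {x y : V} (h : T.Adj x y) : ¬ T.Adj y x :=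
  fun h' => T.ne_of_adj h (T.antisymm x y h h')

theorem not_adj_iff {x y : V} (hxy : x ≠ y) : ¬ T.Adj x y ↔ T.Adj y x :=
  ⟨(T.complete x y hxy).resolve_left, T.not_adj_of_adj⟩

/-- The dual tournament, with all edges reversed. -/
def dual : Tournament V where
  Adj x y := T.Adj y x
  irrefl := T.irrefl
  antisymm x y h h' := T.antisymm x y h' h
  complete x y h := (T.complete x y h).symm

theorem profile_dual : T.dual.profile = T.profile := by
  funext n
  refine Nat.card_congr (Quotient.congr (Equiv.refl _) fun A B => ?_)
  exact ⟨fun ⟨e⟩ => ⟨e.swap⟩, fun ⟨e⟩ => ⟨e.swap⟩⟩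

variable {T} in
theorem IsAutonomous.of_dual {A : Set V} (hA : T.dual.IsAutonomous A) : T.IsAutonomous A := by
  intro x hx x' hx' y hy
  rw [← T.not_adj_iff (ne_of_mem_of_not_mem hx hy).symm,
    ← T.not_adj_iff (ne_of_mem_of_not_mem hx' hy).symm]
  exact not_congr (hA x hx x' hx' y hy)

variable {T} in
theorem IsIndecomposable.dual (hT : T.IsIndecomposable) : T.dual.IsIndecomposable :=
  fun A hA => hT A hA.of_dual

theorem profile_pos [Infinite V] (n : ℕ) : 0 < T.profile n := by
  obtain ⟨A, hA⟩ := Infinite.exists_subset_card_eq V n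
  have : Nonempty (Quotient (T.isoSetoid n)) := ⟨⟦⟨A, hA⟩⟧⟩
  exact Nat.card_pos

/-- The isomorphism type of the subtournament of `T` induced on the range of `g`. -/
def isoType {ι : Type*} [Fintype ι] (g : ι ↪ V) : Quotient (T.isoSetoid (Fintype.card ι)) :=
  ⟦⟨Finset.univ.map g, by simp⟩⟧

theorem isoType_eq_isoType_iff {ι : Type*} [Fintype ι] {g g' : ι ↪ V} :
    T.isoType g = T.isoType g' ↔ Nonempty ((g ⁻¹'o T.Adj) ≃r (g' ⁻¹'o T.Adj)) := by
  let range_equiv (g : ι ↪ V) : ι ≃ (Finset.univ.map g : Set V) :=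
    (Equiv.ofInjective g g.injective).trans (Equiv.setCongr (by simp))
  let iso (g : ι ↪ V) : (g ⁻¹'o T.Adj) ≃r (T.induce (Finset.univ.map g : Set V)).Adj :=
    RelIso.preimage (range_equiv g) (T.induce _).Adj
  refine Quotient.eq.trans ⟨fun ⟨e⟩ => ⟨?_⟩, fun ⟨e⟩ => ⟨?_⟩⟩
  · exact ((iso g).trans e).trans (iso g').symm
  · exact ((iso g).symm.trans e).trans (iso g')

theorem card_le_mul_profile {ι Ω : Type*} [Fintype ι] [Fintype Ω] (g : Ω → ι ↪ V) (p : ι)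
    (h : ∀ (w w' : Ω) (e : (g w ⁻¹'o T.Adj) ≃r (g w' ⁻¹'o T.Adj)), e p = p → w = w') :
    Fintype.card Ω ≤ Fintype.card ι * T.profile (Fintype.card ι) := by
  classical
  have : Fintype (Quotient (T.isoSetoid (Fintype.card ι))) := Fintype.ofFinite _
  -- Isomorphisms onto a fixed member of an isomorphism class send `p` to distinct points.
  have card_fiber_le (w₀ : Ω) :
      Fintype.card {w // T.isoType (g w) = T.isoType (g w₀)} ≤ Fintype.card ι := by
    let e (w : {w // T.isoType (g w) = T.isoType (g w₀)}) :=
      (T.isoType_eq_isoType_iff.1 w.2).some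
    refine Fintype.card_le_of_injective (fun w => e w p) fun w w' hww' => Subtype.ext ?_
    exact h w w' ((e w).trans (e w').symm) ((e w').symm_apply_eq.2 hww')
  calc Fintype.card Ω
      ≤ Fintype.card ι * (Finset.univ.image fun w => T.isoType (g w)).card := by
        refine Finset.card_le_mul_card_image _ _ fun t ht => ?_
        obtain ⟨w₀, -, rfl⟩ := Finset.mem_image.1 ht
        rw [← Fintype.card_subtype]
        exact card_fiber_le w₀
    _ ≤ Fintype.card ι * T.profile (Fintype.card ι) := by
        rw [profile, Nat.card_eq_fintype_card]
        exact Nat.mul_le_mul_left _ (Finset.card_le_univ _)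

/-- Every term of `u` dominates the later terms of `v`. No condition is put on terms of equal index,
so that `T.Before u u` says that `u` is a chain. -/
def Before (u v : ℕ → V) : Prop := ∀ i j, i < j → T.Adj (u i) (v j)

/-- Every term of `u` is dominated by the later terms of `v`. This is `Before` in the dual
tournament, and not `Before` with `u` and `v` exchanged. -/
def After (u v : ℕ → V) : Prop := ∀ i j, i < j → T.Adj (v j) (u i)

section WordCode

variable {α β ι κ σ : Type*}

/-- The family of vertices coding the word `k : ι → κ`: it consists of a chain `b`, of the blocks
`d (k i)` of the letters of the word, and of a base point `p`. The chain and the base point are the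
same for all words; the chain serves to recognize the letters. -/
def wordCode (b : β → α) (d : κ → σ → α) (p : α) (k : ι → κ) : Option (β ⊕ ι × σ) → α
  | none => p
  | some (.inl j) => b j
  | some (.inr (i, t)) => d (k i) t

theorem wordCode_injective {b : β → α} {d : κ → σ → α} {p : α} {k : ι → κ}
    (hb : b.Injective) (hd : ∀ {k k' t t'}, d k t = d k' t' → k = k' ∧ t = t')
    (hbd : ∀ j k t, b j ≠ d k t) (hbp : ∀ j, b j ≠ p) (hdp : ∀ k t, d k t ≠ p)
    (hk : k.Injective) : (wordCode b d p k).Injective := by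
  rintro (- | j | ⟨i, t⟩) (- | j' | ⟨i', t'⟩) h
  · rfl
  · exact absurd h.symm (hbp j')
  · exact absurd h.symm (hdp _ t')
  · exact absurd h (hbp j)
  · rw [hb h]
  · exact absurd h (hbd j _ t')
  · exact absurd h (hdp _ t)
  · exact absurd h.symm (hbd j' _ t)
  · obtain ⟨hi, rfl⟩ := hd h
    rw [hk hi]

/-- The chain of the codes of words of shape `ι` is recognizable: an isomorphism between two codes
that fixes the base point never maps a vertex of the chain to a vertex of a letter. -/
def ChainRecognizable (b : β → V) (d : κ → σ → V) (p : V) (ι : Type*) : Prop :=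
  ∀ (k k' : ι → κ) (e : (wordCode b d p k ⁻¹'o T.Adj) ≃r (wordCode b d p k' ⁻¹'o T.Adj)) (j : β)
    (y : ι × σ), e none = none → e (some (.inl j)) ≠ some (.inr y)

variable {T}

theorem wordCode_iso_apply_chain [LinearOrder β] [Finite β] {b : β → V}
    {d : κ → σ → V} {p : V} {k k' : ι → κ} (hb : ∀ i j, i < j → T.Adj (b i) (b j))
    (hchain : T.ChainRecognizable b d p ι)
    (e : (wordCode b d p k ⁻¹'o T.Adj) ≃r (wordCode b d p k' ⁻¹'o T.Adj)) (hp : e none = none)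
    (j : β) :
    e (some (.inl j)) = some (.inl j) := by
  have exists_eq_inl (j : β) : ∃ j', e (some (.inl j)) = some (.inl j') := by
    rcases h : e (some (.inl j)) with - | j' | y
    · simpa using e.injective (h.trans hp.symm)
    · exact ⟨j', rfl⟩
    · exact absurd h (hchain k k' e j y hp)
  choose f hf using exists_eq_inl
  have f_strictMono : StrictMono f := by
    intro i j hij
    have hadj : T.Adj (b (f i)) (b (f j)) := by
      have := e.map_rel_iff.2 (show (wordCode b d p k ⁻¹'o T.Adj) (some (.inl i)) (some (.inl j))
        from hb i j hij)
      rwa [hf, hf] at this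
    rcases lt_trichotomy (f i) (f j) with h | h | h
    · exact h
    · exact absurd (congrArg b h) (T.ne_of_adj hadj)
    · exact absurd (hb _ _ h) (T.not_adj_of_adj hadj)
  rw [hf, le_antisymm f_strictMono.apply_le f_strictMono.le_apply]

theorem wordCode_iso_apply_letter [Finite β] [LinearOrder β] {b : β → V} {d : κ → σ → V} {p : V}
    {k k' : ι → κ} (hb : ∀ i j, i < j → T.Adj (b i) (b j))
    (hd : ∀ k k' t t', (∀ j, T.Adj (d k t) (b j) ↔ T.Adj (d k' t') (b j)) → k = k')
    (hchain : T.ChainRecognizable b d p ι)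
    (e : (wordCode b d p k ⁻¹'o T.Adj) ≃r (wordCode b d p k' ⁻¹'o T.Adj)) (hp : e none = none)
    (i : ι) (t : σ) :
    ∃ i' t', e (some (.inr (i, t))) = some (.inr (i', t')) ∧ k i = k' i' := by
  have hfix := wordCode_iso_apply_chain hb hchain e hp
  rcases h : e (some (.inr (i, t))) with - | j | ⟨i', t'⟩
  · simpa using e.injective (h.trans hp.symm)
  · simpa using e.injective (h.trans (hfix j).symm)
  · refine ⟨i', t', rfl, hd _ _ t t' fun j => ?_⟩
    have := e.map_rel_iff (a := some (.inr (i, t))) (b := some (.inl j))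
    rw [h, hfix] at this
    exact this.symm

theorem two_pow_le_mul_profile [LinearOrder β] [Fintype β] [Fintype ι] [Fintype κ] [Fintype σ]
    [Nonempty σ] {b : β → V} {d : κ → σ → V} {p : V} (hb : ∀ i j, i < j → T.Adj (b i) (b j))
    (hd : ∀ k k' t t', (∀ j, T.Adj (d k t) (b j) ↔ T.Adj (d k' t') (b j)) → k = k')
    (hinj : ∀ k : ι ↪ κ, (wordCode b d p k).Injective)
    (hchain : T.ChainRecognizable b d p ι)
    (hcard : 2 * Fintype.card ι ≤ Fintype.card κ) :
    2 ^ Fintype.card ι ≤ (Fintype.card β + Fintype.card ι * Fintype.card σ + 1) *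
      T.profile (Fintype.card β + Fintype.card ι * Fintype.card σ + 1) := by
  classical
  -- The `i`-th letter of a word is one of two letters reserved for the position `i`.
  obtain ⟨c⟩ : Nonempty (ι × Bool ↪ κ) :=
    Function.Embedding.nonempty_of_card_le (by simpa [mul_comm] using hcard)
  let word (w : ι → Bool) : ι ↪ κ :=
    ⟨fun i => c (i, w i), fun _ _ h => congrArg Prod.fst (c.injective h)⟩
  have word_eq_of_iso (w w' : ι → Bool) (e : (wordCode b d p (word w) ⁻¹'o T.Adj) ≃r
      (wordCode b d p (word w') ⁻¹'o T.Adj)) (hp : e none = none) : w = w' := by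
    funext i
    obtain ⟨i', -, -, h⟩ := wordCode_iso_apply_letter hb hd hchain e hp i
      (Classical.arbitrary σ)
    obtain ⟨rfl, hi⟩ := Prod.mk.inj (c.injective h)
    exact hi
  simpa using T.card_le_mul_profile (fun w => ⟨wordCode b d p (word w), hinj (word w)⟩) none
    word_eq_of_iso

theorem growth_of_wordCode [Infinite V] [Finite σ] [Nonempty σ] {b : ℕ → V} {d : ℕ → σ → V}
    {p : ℕ → V} (hb : T.Before b b)
    (hd : ∀ k k' t t', k < k' → ¬(T.Adj (d k t) (b k) ↔ T.Adj (d k' t') (b k)))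
    (hinj : ∀ m N (k : Fin m ↪ Fin N),
      (wordCode (fun j : Fin N => b j) (fun j : Fin N => d j) (p N) k).Injective)
    (hchain : ∀ m N,
      T.ChainRecognizable (fun j : Fin N => b j) (fun j : Fin N => d j) (p N) (Fin m)) :
    GrowthAtLeastExponential T.profile := by
  have := Fintype.ofFinite σ
  refine .of_two_pow_le (Fintype.card σ) (T.profile_pos 0) fun m N hmN => ?_
  have row_injective (k k' : Fin N) (t t')
      (h : ∀ j : Fin N, T.Adj (d k t) (b j) ↔ T.Adj (d k' t') (b j)) : k = k' := by
    rcases lt_trichotomy k k' with hk | hk | hk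
    · exact absurd (h k) (hd k k' t t' hk)
    · exact hk
    · exact absurd (h k').symm (hd k' k t' t hk)
  simpa using two_pow_le_mul_profile (b := fun j : Fin N => b j) (d := fun j : Fin N => d j)
    (fun i j hij => hb i j hij) row_injective (hinj m N) (hchain m N) (by simpa using hmN)

end WordCode

section Configurations

variable {T}

variable (T) in
/-- The vertex `p` separates the vertices `b i` from the vertices `d i`, for `i` in `I`. -/
def SeparatesOn (I : Set ℕ) (p : V) (b d : ℕ → V) : Prop :=
  (∀ i ∈ I, T.Adj p (b i) ∧ T.Adj (d i) p) ∨ (∀ i ∈ I, T.Adj (b i) p ∧ T.Adj p (d i))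

namespace SeparatesOn

variable {I : Set ℕ} {p : V} {b d : ℕ → V} {i j : ℕ}

theorem chain_ne (h : T.SeparatesOn I p b d) (hi : i ∈ I) : b i ≠ p :=
  h.elim (fun h => (T.ne_of_adj (h i hi).1).symm) fun h => T.ne_of_adj (h i hi).1

theorem letter_ne (h : T.SeparatesOn I p b d) (hi : i ∈ I) : d i ≠ p :=
  h.elim (fun h => T.ne_of_adj (h i hi).2) fun h => (T.ne_of_adj (h i hi).2).symm

theorem not_adj_iff_adj (h : T.SeparatesOn I p b d) (hi : i ∈ I) (hj : j ∈ I) :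
    ¬(T.Adj p (b i) ↔ T.Adj p (d j)) := by
  rcases h with h | h
  · exact fun e => T.not_adj_of_adj (h j hj).2 (e.1 (h i hi).1)
  · exact fun e => T.not_adj_of_adj (h i hi).1 (e.2 (h j hj).2)

end SeparatesOn

theorem Before.injective {x : ℕ → V} (hx : T.Before x x) : x.Injective :=
  .of_lt_imp_ne fun i j hij => T.ne_of_adj (hx i j hij)

/-- The base point tells the letters from the chain, which therefore is recognizable. -/
theorem growth_of_separatesOn [Infinite V] {b d : ℕ → V} (hb : T.Before b b)
    (hd : ∀ k k', k < k' → ¬(T.Adj (d k) (b k) ↔ T.Adj (d k') (b k)))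
    (hp : ∀ N, ∃ p, T.SeparatesOn (Set.Ioo 0 N) p b d) : GrowthAtLeastExponential T.profile := by
  choose p hp using hp
  have mem_Ioo {N : ℕ} (j : Fin N) : (j + 1 : ℕ) ∈ Set.Ioo 0 (N + 1) := by simp
  have d_injective : d.Injective :=
    .of_lt_imp_ne fun k k' hk e => hd k k' hk (by rw [e])
  refine growth_of_wordCode (b := fun j => b (j + 1)) (d := fun j (_ : Unit) => d (j + 1))
    (p := fun N => p (N + 1)) (fun i j hij => hb _ _ (Nat.succ_lt_succ hij))
    (fun k k' _ _ hk => hd _ _ (Nat.succ_lt_succ hk)) (fun m N k => ?_)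
    fun m N k k' e j ⟨i, t⟩ hep hej => ?_
  · refine wordCode_injective (fun i j h => ?_) (fun {k k'} _ _ h => ?_) (fun j k _ h => ?_)
      (fun j => (hp _).chain_ne (mem_Ioo j)) (fun k _ => (hp _).letter_ne (mem_Ioo k)) k.injective
    · exact Fin.ext (Nat.succ_injective (hb.injective h))
    · exact ⟨Fin.ext (Nat.succ_injective (d_injective h)), rfl⟩
    · exact (hp _).not_adj_iff_adj (mem_Ioo j) (mem_Ioo k) (by rw [h])
  · have := e.map_rel_iff (a := none) (b := some (.inl j))
    rw [hep, hej] at this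
    exact (hp _).not_adj_iff_adj (mem_Ioo j) (mem_Ioo (k' i)) this.symm

theorem growth_of_interleaved [Infinite V] {x v : ℕ → V} (hx : T.Before x x)
    (hv : (T.Before v x ∧ T.Before x v) ∨ (T.After v x ∧ T.After x v))
    (hp : ∀ N, ∃ p, T.SeparatesOn (Set.Ioo 0 N) p x v) : GrowthAtLeastExponential T.profile := by
  -- `x (2 * k + 1)` lies between `v (2 * k)` and the later letters.
  refine growth_of_separatesOn (b := fun j => x (2 * j + 1)) (d := fun k => v (2 * k))
    (fun i j hij => hx _ _ (by omega)) (fun k k' hk h => ?_) fun N => ?_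
  · rcases hv with ⟨hvx, hxv⟩ | ⟨hvx, hxv⟩
    · exact T.not_adj_of_adj (hxv (2 * k + 1) (2 * k') (by omega)) (h.1 (hvx _ _ (by omega)))
    · exact T.not_adj_of_adj (hvx (2 * k) (2 * k + 1) (by omega)) (h.2 (hxv _ _ (by omega)))
  · obtain ⟨p, hp⟩ := hp (2 * N)
    have mem_Ioo (i : ℕ) (hi : i ∈ Set.Ioo 0 N) :
        2 * i + 1 ∈ Set.Ioo 0 (2 * N) ∧ 2 * i ∈ Set.Ioo 0 (2 * N) := by
      simp only [Set.mem_Ioo] at hi ⊢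
      omega
    refine ⟨p, hp.imp (fun hp i hi => ?_) fun hp i hi => ?_⟩
    all_goals exact ⟨(hp _ (mem_Ioo i hi).1).1, (hp _ (mem_Ioo i hi).2).2⟩

theorem growth_of_after_after [Infinite V] {x v : ℕ → V} (hx : T.Before x x)
    (hvx : T.After v x) (hxv : T.After x v) : GrowthAtLeastExponential T.profile :=
  growth_of_interleaved hx (.inr ⟨hvx, hxv⟩) fun _ =>
    ⟨x 0, .inl fun i hi => ⟨hx 0 i hi.1, hxv 0 i hi.1⟩⟩

theorem growth_of_before_before_after [Infinite V] {x v : ℕ → V} (hx : T.Before x x)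
    (hvx : T.Before v x) (hxv : T.Before x v) (hv : T.After v v) :
    GrowthAtLeastExponential T.profile :=
  growth_of_interleaved hx (.inl ⟨hvx, hxv⟩) fun _ =>
    ⟨v 0, .inl fun i hi => ⟨hvx 0 i hi.1, hv 0 i hi.1⟩⟩

theorem growth_of_off_diagonal [Infinite V] {x v : ℕ → V} (hx : T.Before x x)
    (hv : T.Before v v ∨ T.After v v)
    (h : (T.Before v x ∧ T.After x v ∧ ∀ i, T.Adj (x i) (v i)) ∨
      (T.After v x ∧ T.Before x v ∧ ∀ i, T.Adj (v i) (x i))) :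
    GrowthAtLeastExponential T.profile := by
  refine growth_of_separatesOn (d := v) hx (fun k k' hk e => ?_) fun N => ?_
  · rcases h with ⟨-, hxv, hdiag⟩ | ⟨-, hxv, hdiag⟩
    · exact T.not_adj_of_adj (hdiag k) (e.2 (hxv _ _ hk))
    · exact T.not_adj_of_adj (hxv _ _ hk) (e.1 (hdiag k))
  · rcases h with ⟨hvx, hxv, -⟩ | ⟨hvx, hxv, -⟩ <;> rcases hv with hv | hv
    · exact ⟨v N, .inl fun i hi => ⟨hxv i N hi.2, hv i N hi.2⟩⟩
    · exact ⟨v 0, .inl fun i hi => ⟨hvx 0 i hi.1, hv 0 i hi.1⟩⟩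
    · exact ⟨v 0, .inr fun i hi => ⟨hvx 0 i hi.1, hv 0 i hi.1⟩⟩
    · exact ⟨v N, .inr fun i hi => ⟨hxv i N hi.2, hv i N hi.2⟩⟩

/-- The columns `{x i, y i}` form an infinite chain: every vertex of a column dominates all the
vertices of the later columns. -/
structure Interlaced (T : Tournament V) (x y : ℕ → V) : Prop where
  left : T.Before x x
  right : T.Before y y
  left_right : T.Before x y
  right_left : T.Before y x

namespace Interlaced

variable {x y v : ℕ → V}

theorem symm (h : T.Interlaced x y) : T.Interlaced y x :=
  ⟨h.right, h.left, h.right_left, h.left_right⟩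

theorem growth_of_before_after [Infinite V] (h : T.Interlaced x y) (hvx : T.Before v x)
    (hvy : T.After v y) : GrowthAtLeastExponential T.profile :=
  growth_of_interleaved h.left (.inl ⟨h.right_left, h.left_right⟩) fun _ =>
    ⟨v 0, .inl fun i hi => ⟨hvx 0 i hi.1, hvy 0 i hi.1⟩⟩

theorem growth_of_after_before [Infinite V] (h : T.Interlaced x y) (hxv : T.After x v)
    (hyv : T.Before y v) : GrowthAtLeastExponential T.profile :=
  growth_of_interleaved h.left (.inl ⟨h.right_left, h.left_right⟩) fun N =>
    ⟨v N, .inl fun i hi => ⟨hxv i N hi.2, hyv i N hi.2⟩⟩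

end Interlaced

section ThreeCycles

variable {X : Fin 3 → ℕ → V}

theorem le_of_adj_of_before (hX : ∀ s t, T.Before (X s) (X t)) {s t : Fin 3} {i j : ℕ}
    (h : T.Adj (X s i) (X t j)) : i ≤ j :=
  not_lt.1 fun hji => T.not_adj_of_adj h (hX t s j i hji)

theorem eq_and_eq_of_threeCycles (hX : ∀ s t, T.Before (X s) (X t))
    (hc : ∀ i t, T.Adj (X t i) (X (t + 1) i)) {s t : Fin 3} {i j : ℕ} (h : X s i = X t j) :
    i = j ∧ s = t := by
  obtain rfl : i = j := by
    rcases lt_trichotomy i j with hij | hij | hij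
    · exact absurd h (T.ne_of_adj (hX s t i j hij))
    · exact hij
    · exact absurd h.symm (T.ne_of_adj (hX t s j i hij))
  refine ⟨rfl, ?_⟩
  by_contra hst
  obtain rfl | rfl : t = s + 1 ∨ s = t + 1 := by omega
  · exact T.ne_of_adj (hc i s) h
  · exact T.ne_of_adj (hc i t) h.symm

theorem not_threeCycle_wordCode (hX : ∀ s t, T.Before (X s) (X t)) {m N : ℕ} {k : Fin m → Fin N}
    {j : Fin N} {a a' : Option (Fin N ⊕ Fin m × Fin 3)} {c : Option (Fin N ⊕ Fin m × Fin 3) → V}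
    (hc : c = wordCode (fun j : Fin N => X 0 (2 * j + 1)) (fun k : Fin N => fun t => X t (2 * k))
      (X 0 (2 * N + 1)) k)
    (ha : T.Adj (c (some (.inl j))) (c a)) (ha' : T.Adj (c a) (c a')) :
    ¬T.Adj (c a') (c (some (.inl j))) := by
  have exists_column (a) : ∃ s l, c a = X s l ∧ (l = 2 * j + 1 → a = some (.inl j)) := by
    subst hc
    rcases a with - | j' | ⟨i, t⟩
    · exact ⟨0, 2 * N + 1, rfl, by omega⟩
    · exact ⟨0, 2 * j' + 1, rfl, fun h => by rw [Fin.ext (by omega : (j' : ℕ) = j)]⟩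
    · exact ⟨t, 2 * k i, rfl, by omega⟩
  intro h
  obtain ⟨s, l, hs, hl⟩ := exists_column a
  obtain ⟨s', l', hs', -⟩ := exists_column a'
  have hj : c (some (.inl j)) = X 0 (2 * j + 1) := by rw [hc, wordCode]
  rw [hs, hs'] at ha'
  rw [hs', hj] at h
  have hjl : 2 * j + 1 ≤ l := by
    rw [hj, hs] at ha
    exact le_of_adj_of_before hX ha
  have hll' : l ≤ l' := le_of_adj_of_before hX ha'
  have hlj' : l' ≤ 2 * j + 1 := le_of_adj_of_before hX h
  rw [hl (by omega)] at ha
  exact T.irrefl _ ha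

/-- Words are coded by the lexicographic sums of singletons, in the odd columns, and three-cycles,
in the even columns selected by the word: a vertex belongs to the chain if and only if it does not
lie on a three-cycle. -/
theorem growth_of_sum_threeCycles [Infinite V] (hX : ∀ s t, T.Before (X s) (X t))
    (hc : ∀ i t, T.Adj (X t i) (X (t + 1) i)) : GrowthAtLeastExponential T.profile := by
  have hinj {s t i j} (h : X s i = X t j) := eq_and_eq_of_threeCycles hX hc h
  refine growth_of_wordCode (b := fun j => X 0 (2 * j + 1)) (d := fun k t => X t (2 * k))
    (p := fun N => X 0 (2 * N + 1)) (fun i j hij => hX _ _ _ _ (by omega))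
    (fun k k' t t' hk h => ?_) (fun m N k => ?_) fun m N k k' e j ⟨i, t⟩ _ hej => ?_
  · exact T.not_adj_of_adj (hX 0 t' (2 * k + 1) (2 * k') (by omega))
      (h.1 (hX _ _ _ _ (by omega)))
  · refine wordCode_injective (fun i j h => ?_) (fun {k k'} t t' h => ?_) (fun j k t h => ?_)
      (fun j h => ?_) (fun k t h => ?_) k.injective
    all_goals
      have := hinj h
      omega
  · have adj_preimage (t : Fin 3) := e.symm.map_rel_iff.2
      (show (wordCode _ _ _ k' ⁻¹'o T.Adj) (some (.inr (i, t))) (some (.inr (i, t + 1)))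
        from hc (2 * k' i) t)
    have hj : e.symm (some (.inr (i, t))) = some (.inl j) := (e.symm_apply_eq).2 hej.symm
    have h₁ := adj_preimage t
    have h₂ := adj_preimage (t + 1)
    have h₃ := adj_preimage (t + 1 + 1)
    rw [add_assoc t 1 1, add_assoc t, show (1 + 1 + 1 : Fin 3) = 0 from rfl, add_zero] at h₃
    rw [hj] at h₁ h₃
    rw [add_assoc t 1 1] at h₂
    exact not_threeCycle_wordCode hX rfl h₁ h₂ h₃

end ThreeCycles

end Configurations

section Indiscernible

variable {σ : Type*}

/-- The columns `X s` are order-indiscernible: whether `X s i` dominates `X t j` depends only on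
`s`, on `t` and on the order of `i` and `j`. -/
def Indiscernible (X : σ → ℕ → V) : Prop :=
  ∀ s t i j i' j', cmp i j = cmp i' j' → (T.Adj (X s i) (X t j) ↔ T.Adj (X s i') (X t j'))

theorem exists_strictMono_indiscernible [Finite σ] (X : σ → ℕ → V) :
    ∃ φ : ℕ → ℕ, StrictMono φ ∧ T.Indiscernible fun s i => X s (φ i) := by
  obtain ⟨φ, c, hφ, hc⟩ := exists_strictMono_monochromatic fun i j =>
    (fun s t : σ => (T.Adj (X s i) (X t j), T.Adj (X s j) (X t i), T.Adj (X s i) (X t i)))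
  refine ⟨φ, hφ, fun s t i j i' j' h => ?_⟩
  have color_eq {i j i' j'} (h : i < j) (h' : i' < j') :=
    congrFun (congrFun ((hc i j h).trans (hc i' j' h').symm) s) t
  simp only [Prod.mk.injEq, eq_iff_iff] at color_eq
  rcases lt_trichotomy i j with hij | rfl | hij
  · rw [hij.cmp_eq_lt, eq_comm, cmp_eq_lt_iff] at h
    exact (color_eq hij h).1
  · rw [cmp_self_eq_eq, eq_comm, cmp_eq_eq_iff] at h
    subst h
    exact (color_eq i.lt_succ_self i'.lt_succ_self).2.2
  · rw [hij.cmp_eq_gt, eq_comm, cmp_eq_gt_iff] at h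
    exact (color_eq hij h).2.1

variable {T}

namespace Indiscernible

variable {X : σ → ℕ → V} {r s t : σ} {i j : ℕ}

theorem adj_diagonal (hX : T.Indiscernible X) (j : ℕ) (h : T.Adj (X s i) (X t i)) :
    T.Adj (X s j) (X t j) :=
  (hX s t i i j j (by simp)).1 h

theorem before_of_adj (hX : T.Indiscernible X) (hij : i < j) (h : T.Adj (X s i) (X t j)) :
    T.Before (X s) (X t) :=
  fun _ _ hij' => (hX s t _ _ _ _ (by rw [hij.cmp_eq_lt, hij'.cmp_eq_lt])).1 h

theorem after_of_adj (hX : T.Indiscernible X) (hij : i < j) (h : T.Adj (X t j) (X s i)) :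
    T.After (X s) (X t) :=
  fun _ _ hij' => (hX t s _ _ _ _ (by rw [hij.cmp_eq_gt, hij'.cmp_eq_gt])).1 h

theorem before_or_after_of_ne (hX : T.Indiscernible X) (hij : i < j) (h : X s i ≠ X t j) :
    T.Before (X s) (X t) ∨ T.After (X s) (X t) :=
  (T.complete _ _ h).imp (hX.before_of_adj hij) (hX.after_of_adj hij)

theorem before_or_after (hX : T.Indiscernible X) (h : (X s).Injective ∨ (X t).Injective) :
    T.Before (X s) (X t) ∨ T.After (X s) (X t) := by
  by_contra hno
  have eq_of_lt {i j : ℕ} (hij : i < j) : X s i = X t j := by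
    by_contra hne
    exact hno (hX.before_or_after_of_ne hij hne)
  rcases h with h | h
  · exact zero_ne_one (h ((eq_of_lt zero_lt_two).trans (eq_of_lt one_lt_two).symm))
  · exact OfNat.one_ne_ofNat 2 (h ((eq_of_lt zero_lt_one).symm.trans (eq_of_lt zero_lt_two)))

theorem growth_of_eq_of_adj_adj [Infinite V] (hX : T.Indiscernible X)
    (hrs : T.Interlaced (X r) (X s)) (hrt : T.Adj (X r 1) (X t 1)) (hts : T.Adj (X t 1) (X s 1))
    (h : X t 0 = X t 1) : GrowthAtLeastExponential T.profile :=
  hrs.symm.growth_of_before_after (hX.before_of_adj zero_lt_one (h ▸ hts))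
    (hX.after_of_adj zero_lt_one (h ▸ hrt))

theorem before_both_or_after_both [Infinite V] (hX : T.Indiscernible X)
    (hg : ¬ GrowthAtLeastExponential T.profile) (hrs : T.Interlaced (X r) (X s)) (t : σ) :
    (T.Before (X t) (X r) ∧ T.Before (X t) (X s)) ∨
      (T.After (X t) (X r) ∧ T.After (X t) (X s)) := by
  rcases hX.before_or_after (s := t) (.inr hrs.left.injective) with htr | htr <;>
    rcases hX.before_or_after (s := t) (.inr hrs.right.injective) with hts | hts
  · exact .inl ⟨htr, hts⟩
  · exact absurd (hrs.growth_of_before_after htr hts) hg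
  · exact absurd (hrs.symm.growth_of_before_after hts htr) hg
  · exact .inr ⟨htr, hts⟩

theorem both_before_or_both_after [Infinite V] (hX : T.Indiscernible X)
    (hg : ¬ GrowthAtLeastExponential T.profile) (hrs : T.Interlaced (X r) (X s)) (t : σ) :
    (T.Before (X r) (X t) ∧ T.Before (X s) (X t)) ∨
      (T.After (X r) (X t) ∧ T.After (X s) (X t)) := by
  rcases hX.before_or_after (t := t) (.inl hrs.left.injective) with hrt | hrt <;>
    rcases hX.before_or_after (t := t) (.inl hrs.right.injective) with hst | hst
  · exact .inl ⟨hrt, hst⟩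
  · exact absurd (hrs.symm.growth_of_after_before hst hrt) hg
  · exact absurd (hrs.growth_of_after_before hrt hst) hg
  · exact .inr ⟨hrt, hst⟩

theorem interlaced_of_adj_adj [Infinite V] (hX : T.Indiscernible X)
    (hg : ¬ GrowthAtLeastExponential T.profile) (hrs : T.Interlaced (X r) (X s))
    (hrt : ∀ i, T.Adj (X r i) (X t i)) (hts : ∀ i, T.Adj (X t i) (X s i)) :
    T.Interlaced (X r) (X t) ∧ T.Interlaced (X t) (X s) := by
  have htt : T.Before (X t) (X t) ∨ T.After (X t) (X t) :=
    hX.before_or_after_of_ne zero_lt_one fun h =>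
      hg (hX.growth_of_eq_of_adj_adj hrs (hrt 1) (hts 1) h)
  rcases hX.before_both_or_after_both hg hrs t with ⟨htr, hts'⟩ | ⟨htr, hts'⟩ <;>
    rcases hX.both_before_or_both_after hg hrs t with ⟨hrt', hst⟩ | ⟨hrt', -⟩
  · rcases htt with htt | htt
    · exact ⟨⟨hrs.left, htt, hrt', htr⟩, ⟨htt, hrs.right, hts', hst⟩⟩
    · exact absurd (growth_of_before_before_after hrs.left htr hrt' htt) hg
  · exact absurd (growth_of_off_diagonal hrs.left htt (.inl ⟨htr, hrt', hrt⟩)) hg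
  · exact absurd (growth_of_off_diagonal hrs.right htt (.inr ⟨hts', hst, hts⟩)) hg
  · exact absurd (growth_of_after_after hrs.left htr hrt') hg

theorem growth_of_threeCycles [Infinite V] (hX : T.Indiscernible X) (hrs : T.Interlaced (X r) (X s))
    (adj_rs : ∀ i, T.Adj (X r i) (X s i)) (hst : ∀ i, T.Adj (X s i) (X t i))
    (htr : ∀ i, T.Adj (X t i) (X r i)) : GrowthAtLeastExponential T.profile := by
  by_contra hg
  obtain ⟨hst', htr'⟩ := hX.interlaced_of_adj_adj hg hrs.symm hst htr
  refine hg (growth_of_sum_threeCycles (X := ![X r, X s, X t]) (fun u v => ?_) fun i u => ?_)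
  · fin_cases u <;> fin_cases v
    exacts [hrs.left, hrs.left_right, htr'.right_left, hrs.right_left, hrs.right, hst'.left_right,
      htr'.left_right, hst'.right_left, htr'.left]
  · fin_cases u
    exacts [adj_rs i, hst i, htr i]

end Indiscernible

end Indiscernible

section Indecomposable

theorem exists_before_or_after [Infinite V] : ∃ a : ℕ → V, T.Before a a ∨ T.After a a := by
  let v (_ : Unit) := Infinite.natEmbedding V
  obtain ⟨φ, hφ, hX⟩ := T.exists_strictMono_indiscernible fun s => v s
  exact ⟨_, hX.before_or_after (s := ()) (t := ()) (.inl ((v ()).injective.comp hφ.injective))⟩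

variable {T}

namespace IsIndecomposable

theorem exists_adj_adj_of_nontrivial (hT : T.IsIndecomposable) {A : Set V} (hA : A.Nontrivial)
    (hA' : A ≠ Set.univ) : ∃ s ∈ A, ∃ s' ∈ A, ∃ z ∉ A, T.Adj s z ∧ T.Adj z s' := by
  by_contra! hno
  have adj_of_adj : ∀ s ∈ A, ∀ s' ∈ A, ∀ z ∉ A, T.Adj s z → T.Adj s' z := by
    intro s hs s' hs' z hz hsz
    exact (T.not_adj_iff (ne_of_mem_of_not_mem hs' hz).symm).1 (hno s hs s' hs' z hz hsz)
  rcases hT A fun s hs s' hs' z hz =>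
    ⟨adj_of_adj s hs s' hs' z hz, adj_of_adj s' hs' s hs z hz⟩ with h | ⟨a, h⟩ | h
  · exact hA.nonempty.ne_empty h
  · exact hA.ne_singleton h
  · exact hA' h

theorem exists_adj_to [Infinite V] (hT : T.IsIndecomposable) (x : V) : ∃ z, T.Adj z x := by
  obtain ⟨s, -, -, -, z, hz, hsz, -⟩ := hT.exists_adj_adj_of_nontrivial
    (Set.finite_singleton x).infinite_compl.nontrivial (by simp)
  obtain rfl : z = x := by simpa using hz
  exact ⟨s, hsz⟩

/-- The closed interval between `x` and `y` is not autonomous; the three cases correspond to the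
position, with respect to `x` and `y`, of a vertex outside of it that separates two of its
vertices. -/
theorem exists_threeCycle [Infinite V] (hT : T.IsIndecomposable) {x y : V} (hxy : T.Adj x y) :
    ∃ u z, (T.Adj y z ∧ T.Adj z x) ∨
      (T.Adj x u ∧ T.Adj u y ∧ T.Adj u z ∧ T.Adj z x) ∨
      (T.Adj x u ∧ T.Adj u y ∧ T.Adj y z ∧ T.Adj z u) := by
  let A : Set V := {s | (s = x ∨ T.Adj x s) ∧ (s = y ∨ T.Adj s y)}
  have hx : x ∈ A := ⟨.inl rfl, .inr hxy⟩
  have hy : y ∈ A := ⟨.inr hxy, .inl rfl⟩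
  have hA : A ≠ Set.univ := by
    obtain ⟨w, hw⟩ := hT.exists_adj_to x
    refine (Set.ne_univ_iff_exists_notMem _).2 ⟨w, fun h => ?_⟩
    exact h.1.elim (T.ne_of_adj hw) (T.not_adj_of_adj hw)
  obtain ⟨s, hs, s', hs', z, hz, hsz, hzs'⟩ :=
    hT.exists_adj_adj_of_nontrivial ⟨x, hx, y, hy, T.ne_of_adj hxy⟩ hA
  have hzx : z ≠ x := (ne_of_mem_of_not_mem hx hz).symm
  have hzy : z ≠ y := (ne_of_mem_of_not_mem hy hz).symm
  rcases T.complete z x hzx with hzx | hxz <;> rcases T.complete y z hzy.symm with hyz | hzy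
  · exact ⟨z, z, .inl ⟨hyz, hzx⟩⟩
  · have hxs : T.Adj x s := hs.1.resolve_left fun h => T.not_adj_of_adj hzx (h ▸ hsz)
    have hsy : T.Adj s y := hs.2.resolve_left fun h => T.not_adj_of_adj hzy (h ▸ hsz)
    exact ⟨s, z, .inr (.inl ⟨hxs, hsy, hsz, hzx⟩)⟩
  · have hxs' : T.Adj x s' := hs'.1.resolve_left fun h => T.not_adj_of_adj hxz (h ▸ hzs')
    have hsy' : T.Adj s' y := hs'.2.resolve_left fun h => T.not_adj_of_adj hyz (h ▸ hzs')
    exact ⟨s', z, .inr (.inr ⟨hxs', hsy', hyz, hzs'⟩)⟩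
  · exact absurd ⟨.inr hxz, .inr hzy⟩ hz

theorem growth_of_before [Infinite V] (hT : T.IsIndecomposable) {a : ℕ → V}
    (ha : T.Before a a) : GrowthAtLeastExponential T.profile := by
  choose u z h using fun i => hT.exists_threeCycle (ha (2 * i) (2 * i + 1) (by omega))
  obtain ⟨φ, hφ, hX⟩ := T.exists_strictMono_indiscernible
    ![fun i => a (2 * i), fun i => a (2 * i + 1), u, z]
  set X : Fin 4 → ℕ → V := fun s i => ![fun i => a (2 * i), fun i => a (2 * i + 1), u, z] s (φ i)
  have h01 : T.Interlaced (X 0) (X 1) := by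
    constructor <;> exact fun i j hij => ha _ _ (by have := hφ hij; omega)
  have adj01 (i) : T.Adj (X 0 i) (X 1 i) := ha _ _ (Nat.lt_succ_self _)
  have adj_of_adj (s t) (hst : T.Adj (X s 0) (X t 0)) (i) : T.Adj (X s i) (X t i) :=
    hX.adj_diagonal i hst
  by_contra hg
  rcases h (φ 0) with ⟨h13, h30⟩ | ⟨h02, h21, h23, h30⟩ | ⟨h02, h21, h13, h32⟩
  · exact hg (hX.growth_of_threeCycles h01 adj01 (adj_of_adj 1 3 h13) (adj_of_adj 3 0 h30))
  all_goals
    have adj02 := adj_of_adj 0 2 h02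
    have adj21 := adj_of_adj 2 1 h21
    obtain ⟨hI02, hI21⟩ := hX.interlaced_of_adj_adj hg h01 adj02 adj21
  · exact hg (hX.growth_of_threeCycles hI02 adj02 (adj_of_adj 2 3 h23) (adj_of_adj 3 0 h30))
  · exact hg (hX.growth_of_threeCycles hI21 adj21 (adj_of_adj 1 3 h13) (adj_of_adj 3 2 h32))

end IsIndecomposable

end Indecomposable

end Tournament

theorem mainTheorem8 {V : Type*} [Infinite V] (T : Tournament V) (hT : T.IsIndecomposable) :
    GrowthAtLeastExponential T.profile := by
  obtain ⟨a, ha | ha⟩ := T.exists_before_or_after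
  · exact hT.growth_of_before ha
  · rw [← T.profile_dual]
    exact hT.dual.growth_of_before (a := a) ha
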